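/- Let $\mathcal X$ be a finite set and let $P_1,P_2$ be two probability distributions on $\mathcal X$ with the same support. Let $X_1,X_2,\dots$ be i.i.d. with distribution $P_i$ under hypothesis $H_i$, $i\in\{1,2\}$; write $P_i$ also for the law of the whole sequence. A hypothesis test consists of a stopping time $\tau$ of the filtration $\sigma(X_1,\dots,X_n)$, $n\ge 0$, and a decision determined by the samples up to time $\tau$; $A_i$ denotes the event that it decides for $H_i$, and $A_2$ is the complement of $A_1$. A pair $(E_1,E_2)\in\mathbb R^2$ is *achievable in a fixed-length manner* if for every $\delta>0$ there is $N(\delta)$ such that for all $n\ge N(\delta)$ there is a test with $\tau\le n$ almost surely under $P_1$ and $P_2$, $P_1(A_2)\le e^{-(E_1-\delta)n}$ and $P_2(A_1)\le e^{-(E_2-\delta)n}$. Let $\mathcal R_{FL}$ be the set of these pairs. For $\gamma\ge 0$ and an integer $K\ge1$, the pair is *achievable in a $(\gamma,K)$-almost-fixed-length manner* if for every $\delta>0$ there is $N(\delta)$ such that for all $n\ge N(\delta)$ there is a test with $P_i(\tau>n)\le e^{-\gamma n}$ and $\tau\le Kn$ $P_i$-almost surely for $i=1,2$, and with the same two bounds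 on $P_1(A_2)$ and $P_2(A_1)$. Let $\mathcal R_{AFL}^{(\gamma,K)}$ be the set of these pairs. Let $\mathcal R_{AFL}^{(0+,K)}$ be defined in the same way with the condition $P_i(\tau>n)\le e^{-\gamma n}$ replaced by $P_i(\tau>n)\le\delta$ (so that $P_i(\tau>n)$ tends to $0$ at no prescribed rate). For $\lambda\in[0,1]$ let $P^{(\lambda)}(x)=P_1(x)^{1-\lambda}P_2(x)^{\lambda}/\sum_{a\in\mathcal X}P_1(a)^{1-\lambda}P_2(a)^{\lambda}$ (with $0^0=1$), let $D(\cdot\|\cdot)$ be the Kullback–Leibler divergence, and put $$E_1(\gamma)=\max_{\lambda\in[0,1]}\{D(P^{(\lambda)}\|P_1): D(P^{(\lambda)}\|P_2)\ge\gamma\},\qquad E_2(\gamma)=\max_{\lambda\in[0,1]}\{D(P^{(\lambda)}\|P_2): D(P^{(\lambda)}\|P_1)\ge\gamma\},$$ where a maximum over the empty set is $-\infty$, and $$\mathcal R_\gamma=\mathcal R_{FL}\cup\big(\{E_1\in\mathbb R: E_1\le E_1(\gamma)\}\times\{E_2\in\mathbb R: E_2\le E_2(\gamma)\}\big).$$ **Proposition.**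 Let $K\ge1$ be an integer. 1. For every $\gamma>0$, $\ \mathcal R_{AFL}^{(\gamma,K)}\subseteq\mathcal R_\gamma\cap K\mathcal R_{FL}$. 2. For $\gamma=0$, $\ \mathcal R_{AFL}^{(0,K)}\subseteq K\mathcal R_{FL}$ and $\mathcal R_{AFL}^{(0+,K)}\subseteq\mathcal R_0\cap K\mathcal R_{FL}$. Here the fixed-length region is explicit for positive exponents: a pair with $E_1>0$ and $E_2>0$ lies in $\mathcal R_{FL}$ if and only if $E_1\le D(P^{(\lambda)}\|P_1)$ and $E_2\le D(P^{(\lambda)}\|P_2)$ for some $\lambda\in[0,1]$. -/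

import Mathlib

open MeasureTheory Set
open scoped ENNReal Pointwise

noncomputable section

namespace AFLTest

/-- The law of an i.i.d. sequence of samples with common distribution `P`; the coordinate `ω k`
of `ω : ℕ → X` is the sample `X_{k+1}`. -/
def iidLaw {X : Type*} [MeasurableSpace X] (P : Measure X) [IsProbabilityMeasure P] :
    Measure (ℕ → X) :=
  Measure.infinitePi (fun _ : ℕ => P)

/-- The filtration `n ↦ σ(X_1, …, X_n)` of the samples (trivial at time `0`). -/
def sampleFiltration (X : Type*) [MeasurableSpace X] :
    Filtration ℕ (MeasurableSpace.pi : MeasurableSpace (ℕ → X)) where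
  seq n := ⨆ k : ℕ, ⨆ _ : k < n, MeasurableSpace.comap (fun ω : ℕ → X => ω k) inferInstance
  mono' := fun _ _ hmn => iSup_mono fun _ => iSup_mono' fun hk => ⟨lt_of_lt_of_le hk hmn, le_rfl⟩
  le' := fun _ => iSup_le fun k => iSup_le fun _ => (measurable_pi_apply k).comap_le

/-- A binary hypothesis test: a stopping time `τ` of the sample filtration, and a decision which
is determined by the samples observed up to time `τ`. The test decides for `H₁` on `acceptOne`
and for `H₂` on its complement. -/
structure HypothesisTest (X : Type*) [MeasurableSpace X] where
  τ : (ℕ → X) → WithTop ℕ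
  isStoppingTime : IsStoppingTime (sampleFiltration X) τ
  acceptOne : Set (ℕ → X)
  measurable_acceptOne : MeasurableSet[isStoppingTime.measurableSpace] acceptOne

section Tests

variable {X : Type*} [MeasurableSpace X]

/-- The event that the test decides for `H₂`. -/
def HypothesisTest.acceptTwo (T : HypothesisTest X) : Set (ℕ → X) := T.acceptOneᶜ

/-- The event `τ > n`. -/
def HypothesisTest.overshoot (T : HypothesisTest X) (n : ℕ) : Set (ℕ → X) :=
  {ω | (n : WithTop ℕ) < T.τ ω}

variable (P₁ P₂ : Measure X) [IsProbabilityMeasure P₁] [IsProbabilityMeasure P₂]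

/-- `τ ≤ m` almost surely under both hypotheses. -/
def HypothesisTest.BoundedBy (T : HypothesisTest X) (m : ℕ) : Prop :=
  (∀ᵐ ω ∂(iidLaw P₁), T.τ ω ≤ (m : WithTop ℕ)) ∧ (∀ᵐ ω ∂(iidLaw P₂), T.τ ω ≤ (m : WithTop ℕ))

/-- Type-I error at most `exp (-(E.1 - δ) n)` and type-II error at most `exp (-(E.2 - δ) n)`. -/
def HypothesisTest.ErrorsLE (T : HypothesisTest X) (E : ℝ × ℝ) (δ : ℝ) (n : ℕ) : Prop :=
  (iidLaw P₁).real T.acceptTwo ≤ Real.exp (-(E.1 - δ) * n) ∧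
    (iidLaw P₂).real T.acceptOne ≤ Real.exp (-(E.2 - δ) * n)

/-- The error-exponent pairs achievable in a fixed-length manner. -/
def regionFL : Set (ℝ × ℝ) :=
  {E | ∀ δ : ℝ, 0 < δ → ∃ N : ℕ, ∀ n : ℕ, N ≤ n → ∃ T : HypothesisTest X,
    T.BoundedBy P₁ P₂ n ∧ T.ErrorsLE P₁ P₂ E δ n}

/-- The error-exponent pairs achievable in a `(γ, K)`-almost-fixed-length manner. -/
def regionAFL (γ : ℝ) (K : ℕ) : Set (ℝ × ℝ) :=
  {E | ∀ δ : ℝ, 0 < δ → ∃ N : ℕ, ∀ n : ℕ, N ≤ n → ∃ T : HypothesisTest X,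
    ((iidLaw P₁).real (T.overshoot n) ≤ Real.exp (-γ * n) ∧
      (iidLaw P₂).real (T.overshoot n) ≤ Real.exp (-γ * n)) ∧
    T.BoundedBy P₁ P₂ (K * n) ∧ T.ErrorsLE P₁ P₂ E δ n}

/-- The error-exponent pairs achievable by tests with `τ ≤ K n` for which the probability of
`τ > n` tends to zero, at no prescribed rate. -/
def regionVanishing (K : ℕ) : Set (ℝ × ℝ) :=
  {E | ∀ δ : ℝ, 0 < δ → ∃ N : ℕ, ∀ n : ℕ, N ≤ n → ∃ T : HypothesisTest X,
    ((iidLaw P₁).real (T.overshoot n) ≤ δ ∧ (iidLaw P₂).real (T.overshoot n) ≤ δ) ∧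
    T.BoundedBy P₁ P₂ (K * n) ∧ T.ErrorsLE P₁ P₂ E δ n}

end Tests

section Tilted

variable {X : Type*} [MeasurableSpace X] [Fintype X] (P₁ P₂ : Measure X)

/-- The unnormalized weight `P₁(x)^(1-l) * P₂(x)^l`. -/
def tiltedWeight (l : ℝ) (x : X) : ℝ≥0∞ := P₁ {x} ^ (1 - l) * P₂ {x} ^ l

/-- The `l`-tilted distribution `P^(l)` with respect to `P₁` and `P₂`. -/
def tilted (l : ℝ) : Measure X :=
  ∑ x : X, (tiltedWeight P₁ P₂ l x / ∑ a : X, tiltedWeight P₁ P₂ l a) • Measure.dirac x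

/-- The Kullback-Leibler divergence `D(P^(l) ‖ Q)`, as an extended real number. -/
def divTilted (l : ℝ) (Q : Measure X) : EReal :=
  ((InformationTheory.klDiv (tilted P₁ P₂ l) Q : ℝ≥0∞) : EReal)

/-- `E₁(γ)`, the maximum of `D(P^(l) ‖ P₁)` over the `l ∈ [0,1]` with `D(P^(l) ‖ P₂) ≥ γ`;
it is `-∞` if there is no such `l`. -/
def maxExponentOne (γ : ℝ) : EReal :=
  sSup {d | ∃ l ∈ Icc (0 : ℝ) 1, (γ : EReal) ≤ divTilted P₁ P₂ l P₂ ∧ d = divTilted P₁ P₂ l P₁}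

/-- `E₂(γ)`, the maximum of `D(P^(l) ‖ P₂)` over the `l ∈ [0,1]` with `D(P^(l) ‖ P₁) ≥ γ`;
it is `-∞` if there is no such `l`. -/
def maxExponentTwo (γ : ℝ) : EReal :=
  sSup {d | ∃ l ∈ Icc (0 : ℝ) 1, (γ : EReal) ≤ divTilted P₁ P₂ l P₁ ∧ d = divTilted P₁ P₂ l P₂}

/-- The region of the pairs with `E_i ≤ D(P^(l) ‖ P_i)`, `i = 1, 2`, for some `l ∈ [0,1]`. -/
def regionTilted : Set (ℝ × ℝ) :=
  {E | ∃ l ∈ Icc (0 : ℝ) 1,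
    (E.1 : EReal) ≤ divTilted P₁ P₂ l P₁ ∧ (E.2 : EReal) ≤ divTilted P₁ P₂ l P₂}

/-- The region `R_γ = R_FL ∪ {E₁ ≤ E₁(γ)} × {E₂ ≤ E₂(γ)}`. -/
def regionGamma [IsProbabilityMeasure P₁] [IsProbabilityMeasure P₂] (γ : ℝ) : Set (ℝ × ℝ) :=
  regionFL P₁ P₂ ∪
    {e : ℝ | (e : EReal) ≤ maxExponentOne P₁ P₂ γ} ×ˢ
      {e : ℝ | (e : EReal) ≤ maxExponentTwo P₁ P₂ γ}

end Tilted

end AFLTest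

end

/-! The converse is a change of measure. Suppose `Q` satisfies `D(Q‖P_i) < E_i` for both `i`. Up to
time `n`, both error events have `P_i`-probabilities too small to carry mass under `Q`, so under `Q`
the test overshoots with probability above `1/2` (`exists_forall_half_lt_overshoot`). If the
overshoot has `P_i`-probability at most `e^{-γn}`, this forces `γ ≤ D(Q‖P_i)`.

Apply this along the tilted path. The interval `[0,1]` is covered by three closed sets of
parameters: `E₁ ≤ D(·‖P₁)`, `E₂ ≤ D(·‖P₂)`, and both divergences at least `γ`. For positive
exponents and `γ > 0`, the first contains `1` and the second contains `0`. If they meet, the pair is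
in the tilted region, which likelihood-ratio tests achieve. Otherwise connectedness makes each of
them meet the third set, and the meeting points witness the bounds by `E₁(γ)` and `E₂(γ)`.

For fixed-length tests `γ` is arbitrary, so the third set disappears and the first two must meet.
For a vanishing overshoot, `Q = P₁` and `Q = P₂` suffice. The factor `K` comes from reading the
horizon `Kn` as the sample size. -/

namespace AFLTest

open Filter Topology ProbabilityTheory

/-! ### Change of measure for i.i.d. samples -/

section ChangeOfMeasure

variable {X : Type*} [MeasurableSpace X]

instance (P : Measure X) [IsProbabilityMeasure P] : IsProbabilityMeasure (iidLaw P) := by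
  unfold iidLaw; infer_instance

lemma sampleFiltration_le_comap_restrict (n : ℕ) :
    sampleFiltration X n ≤
      MeasurableSpace.comap (Finset.range n).restrict MeasurableSpace.pi := by
  refine iSup₂_le fun k hk => ?_
  have h : (fun ω : ℕ → X => ω k) =
      (fun c : Finset.range n → X => c ⟨k, Finset.mem_range.2 hk⟩) ∘ (Finset.range n).restrict := rfl
  rw [h, ← MeasurableSpace.comap_comp]
  exact MeasurableSpace.comap_mono (measurable_pi_apply _).comap_le

lemma measurable_sample {n k : ℕ} (hk : k < n) :
    Measurable[sampleFiltration X n] (fun ω : ℕ → X => ω k) :=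
  Measurable.of_comap_le
    (le_iSup₂_of_le (f := fun k _ => MeasurableSpace.comap (fun ω : ℕ → X => ω k) inferInstance)
      k hk le_rfl)

lemma measurable_sum_samples [Fintype X] [MeasurableSingletonClass X] (n : ℕ) (f : X → ℝ) :
    Measurable[sampleFiltration X n] fun ω : ℕ → X => ∑ k ∈ Finset.range n, f (ω k) :=
  Finset.measurable_fun_sum _ fun _ hk =>
    (Measurable.of_discrete (f := f)).comp (measurable_sample (Finset.mem_range.1 hk))

lemma iidLaw_real_preimage_restrict (P : Measure X) [IsProbabilityMeasure P] [Fintype X]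
    [MeasurableSingletonClass X] (n : ℕ) (C : Finset (Finset.range n → X)) :
    (iidLaw P).real ((Finset.range n).restrict ⁻¹' (C : Set (Finset.range n → X))) =
      ∑ c ∈ C, ∏ k, P.real {c k} := by
  have h : (iidLaw P).map (Finset.range n).restrict = Measure.pi fun _ : Finset.range n => P :=
    Measure.infinitePi_map_restrict _
  rw [← map_measureReal_apply (Finset.measurable_restrict _) C.finite_toSet.measurableSet, h,
    ← sum_measureReal_singleton]
  refine Finset.sum_congr rfl fun c _ => ?_
  simp [measureReal_def, Measure.pi_singleton, ENNReal.toReal_prod]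

/-- A bound on the likelihood ratio of the first `n` samples on an event determined by them bounds
the ratio of its probabilities. -/
lemma iidLaw_real_le_mul [Fintype X] [MeasurableSingletonClass X] (P Q : Measure X)
    [IsProbabilityMeasure P] [IsProbabilityMeasure Q] {n : ℕ} {B : Set (ℕ → X)}
    (hB : MeasurableSet[sampleFiltration X n] B) {M : ℝ}
    (h : ∀ ω ∈ B, ∏ k ∈ Finset.range n, Q.real {ω k} ≤ M * ∏ k ∈ Finset.range n, P.real {ω k}) :
    (iidLaw Q).real B ≤ M * (iidLaw P).real B := by
  obtain ⟨C, -, rfl⟩ := sampleFiltration_le_comap_restrict n B hB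
  have : Nonempty X := nonempty_of_isProbabilityMeasure P
  have hC := C.toFinite.coe_toFinset
  rw [← hC, iidLaw_real_preimage_restrict, iidLaw_real_preimage_restrict, Finset.mul_sum]
  refine Finset.sum_le_sum fun c hc => ?_
  -- The event depends only on the first `n` samples, so any extension of the word `c` lies in it.
  let ω : ℕ → X := fun k => if hk : k ∈ Finset.range n then c ⟨k, hk⟩ else Classical.arbitrary X
  have hω : (Finset.range n).restrict ω = c := by
    ext k
    have hk : (k : ℕ) < n := Finset.mem_range.1 k.2
    simp [ω, hk]
  have h' := h ω (by simpa [hω] using hc)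
  rw [← Finset.prod_attach, ← Finset.prod_attach (Finset.range n)] at h'
  simpa [← hω] using h'

/-- The Kullback-Leibler divergence of two measures on a finite set, as a real number. -/
noncomputable def relEntropy [Fintype X] (Q P : Measure X) : ℝ :=
  ∑ x, Q.real {x} * Real.log (Q.real {x} / P.real {x})

/-- The weak law of large numbers for a function of i.i.d. samples. -/
lemma tendsto_iidLaw_lt_sum [Fintype X] [MeasurableSingletonClass X] (Q : Measure X)
    [IsProbabilityMeasure Q] (f : X → ℝ) {b : ℝ} (hb : ∑ x, Q.real {x} * f x < b) :
    Tendsto (fun n : ℕ => (iidLaw Q).real {ω | n * b < ∑ k ∈ Finset.range n, f (ω k)})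
      atTop (𝓝 0) := by
  have hf : Measurable f := .of_discrete
  have hint : ∀ k : ℕ, Integrable (fun ω : ℕ → X => f (ω k)) (iidLaw Q) := fun k =>
    (measurePreserving_eval_infinitePi (fun _ : ℕ => Q) k).integrable_comp_of_integrable
      (g := f) Integrable.of_finite
  have hmean : ∫ ω, f (ω 0) ∂(iidLaw Q) = ∑ x, Q.real {x} * f x := by
    have := integral_map (μ := iidLaw Q) (φ := fun ω : ℕ → X => ω 0) (f := f)
      (measurable_pi_apply 0).aemeasurable hf.aestronglyMeasurable
    rw [← this]
    have h0 : (iidLaw Q).map (fun ω : ℕ → X => ω 0) = Q :=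
      (measurePreserving_eval_infinitePi (fun _ : ℕ => Q) 0).map_eq
    rw [h0, integral_fintype Integrable.of_finite]
    simp
  have hlaw : ∀ k : ℕ, (iidLaw Q).map (fun ω : ℕ → X => ω k) = Q := fun k =>
    (measurePreserving_eval_infinitePi (fun _ : ℕ => Q) k).map_eq
  have hind : iIndepFun (fun (k : ℕ) (ω : ℕ → X) => f (ω k)) (iidLaw Q) :=
    iIndepFun_infinitePi (P := fun _ : ℕ => Q) (X := fun _ => f) fun _ => hf
  have hslln := strong_law_ae_real (μ := iidLaw Q) (fun k ω => f (ω k)) (hint 0)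
    (fun i j hij => hind.indepFun hij)
    (fun k => (IdentDistrib.comp (u := f) ⟨(measurable_pi_apply k).aemeasurable,
      (measurable_pi_apply 0).aemeasurable, by rw [hlaw, hlaw]⟩ hf))
  rw [hmean] at hslln
  have hmeas := tendstoInMeasure_of_tendsto_ae
    (fun n => ((Finset.measurable_fun_sum _ fun k _ =>
      hf.comp (measurable_pi_apply k)).div_const _).aestronglyMeasurable) hslln
  set m := ∑ x, Q.real {x} * f x with hm
  have h1 := hmeas (ENNReal.ofReal (b - m)) (by simpa using hb)
  have h2 := (ENNReal.tendsto_toReal ENNReal.zero_ne_top).comp h1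
  refine squeeze_zero' (Eventually.of_forall fun _ => measureReal_nonneg) ?_ h2
  filter_upwards [eventually_gt_atTop 0] with n hn
  refine measureReal_mono fun ω hω => ?_
  have hn' : (0 : ℝ) < n := by exact_mod_cast hn
  have h3 : b < (∑ k ∈ Finset.range n, f (ω k)) / n := by
    rw [lt_div_iff₀ hn', mul_comm]; exact hω
  simp only [mem_ofPred_eq, edist_dist]
  refine ENNReal.ofReal_le_ofReal ?_
  rw [Real.dist_eq]
  exact (sub_le_sub_right h3.le m).trans (le_abs_self _)

/-- Events whose `P`-probabilities decay with an exponent larger than `D(Q ‖ P)` have vanishing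
`Q`-probabilities. -/
lemma exists_forall_iidLaw_real_lt [Fintype X] [MeasurableSingletonClass X] {P Q : Measure X}
    [IsProbabilityMeasure P] [IsProbabilityMeasure Q] (hQP : Q ≪ P) {a ε : ℝ}
    (ha : relEntropy Q P < a) (hε : 0 < ε) :
    ∃ N : ℕ, ∀ n ≥ N, ∀ B : Set (ℕ → X), MeasurableSet[sampleFiltration X n] B →
      (iidLaw P).real B ≤ Real.exp (-a * n) → (iidLaw Q).real B < ε := by
  -- Since `D(Q‖P) < b`, a log-likelihood above `nb` is `Q`-rare; elsewhere the change of measure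
  -- costs `e^{nb}`, which `b < a` absorbs.
  obtain ⟨b, hb, hba⟩ := exists_between ha
  set ℓ : X → ℝ := fun x => Real.log (Q.real {x} / P.real {x}) with hℓ
  have h1 := tendsto_iidLaw_lt_sum Q ℓ hb
  have h2 : Tendsto (fun n : ℕ => Real.exp ((b - a) * n)) atTop (𝓝 0) :=
    Real.tendsto_exp_atBot.comp
      (tendsto_natCast_atTop_atTop.const_mul_atTop_of_neg (by linarith))
  have h3 := (h1.add h2).eventually (gt_mem_nhds (by simpa using hε))
  obtain ⟨N, hN⟩ := eventually_atTop.1 h3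
  refine ⟨N, fun n hn B hB hPB => lt_of_le_of_lt ?_ (hN n hn)⟩
  set S : Set (ℕ → X) := {ω | n * b < ∑ k ∈ Finset.range n, ℓ (ω k)} with hS
  have hSm : MeasurableSet[sampleFiltration X n] S := by
    exact @measurableSet_lt _ _ _ _ _ (sampleFiltration X n) _ _ _ _ _ measurable_const
      (measurable_sum_samples n ℓ)
  have h4 : (iidLaw Q).real (B \ S) ≤ Real.exp (n * b) * (iidLaw P).real (B \ S) := by
    refine iidLaw_real_le_mul P Q (hB.diff hSm) fun ω hω => ?_
    have hsum : ∑ k ∈ Finset.range n, ℓ (ω k) ≤ n * b := not_lt.1 hω.2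
    -- At a `Q`-null point `ℓ` takes the junk value `log 0 = 0`, but then the `Q`-product vanishes.
    by_cases h0 : ∃ k ∈ Finset.range n, Q.real {ω k} = 0
    · obtain ⟨k, hk, hk0⟩ := h0
      rw [Finset.prod_eq_zero hk hk0]
      exact mul_nonneg (Real.exp_pos _).le (Finset.prod_nonneg fun _ _ => measureReal_nonneg)
    · push Not at h0
      have hq : ∀ k ∈ Finset.range n, Q.real {ω k} = Real.exp (ℓ (ω k)) * P.real {ω k} := by
        intro k hk
        have hq0 : 0 < Q.real {ω k} := lt_of_le_of_ne measureReal_nonneg (h0 k hk).symm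
        have hp0 : 0 < P.real {ω k} := by
          refine lt_of_le_of_ne measureReal_nonneg fun h => h0 k hk ?_
          rw [eq_comm, measureReal_eq_zero_iff] at h
          rw [measureReal_eq_zero_iff]
          exact hQP h
        rw [hℓ, Real.exp_log (by positivity), div_mul_cancel₀ _ hp0.ne']
      rw [Finset.prod_congr rfl hq, Finset.prod_mul_distrib, ← Real.exp_sum]
      exact mul_le_mul_of_nonneg_right (Real.exp_le_exp.2 hsum)
        (Finset.prod_nonneg fun _ _ => measureReal_nonneg)
  have h5 : (iidLaw Q).real B ≤ (iidLaw Q).real S + (iidLaw Q).real (B \ S) := by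
    refine (measureReal_mono ?_).trans (measureReal_union_le _ _)
    rw [union_sdiff_self]; exact subset_union_right
  refine h5.trans (add_le_add le_rfl (h4.trans ?_))
  calc Real.exp (n * b) * (iidLaw P).real (B \ S)
      ≤ Real.exp (n * b) * Real.exp (-a * n) :=
        mul_le_mul_of_nonneg_left ((measureReal_mono sdiff_subset).trans hPB) (Real.exp_pos _).le
    _ = Real.exp ((b - a) * n) := by rw [← Real.exp_add]; ring_nf

end ChangeOfMeasure

/-! ### The converse for tests -/

section Converse

variable {X : Type*} [MeasurableSpace X] {P₁ P₂ : Measure X} [IsProbabilityMeasure P₁]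
  [IsProbabilityMeasure P₂]

lemma HypothesisTest.ErrorsLE.mono {T : HypothesisTest X} {E : ℝ × ℝ} {δ δ' : ℝ} {n : ℕ}
    (h : T.ErrorsLE P₁ P₂ E δ n) (hδ : δ ≤ δ') : T.ErrorsLE P₁ P₂ E δ' n := by
  constructor
  · refine h.1.trans (Real.exp_le_exp.2 ?_)
    gcongr
  · refine h.2.trans (Real.exp_le_exp.2 ?_)
    gcongr

lemma HypothesisTest.measurableSet_overshoot (T : HypothesisTest X) (n : ℕ) :
    MeasurableSet[sampleFiltration X n] (T.overshoot n) := by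
  have h := (T.isStoppingTime n).compl
  convert h using 1
  ext ω
  simp [overshoot]

/-- If the exponents exceed the divergences from `Q`, a test is unlikely to have stopped
by time `n` under `Q`. -/
lemma exists_forall_half_lt_overshoot [Fintype X] [MeasurableSingletonClass X] {Q : Measure X}
    [IsProbabilityMeasure Q] (h₁ : Q ≪ P₁) (h₂ : Q ≪ P₂) {E : ℝ × ℝ}
    (hE₁ : relEntropy Q P₁ < E.1) (hE₂ : relEntropy Q P₂ < E.2) :
    ∃ δ : ℝ, 0 < δ ∧ ∃ N : ℕ, ∀ n ≥ N, ∀ T : HypothesisTest X, T.ErrorsLE P₁ P₂ E δ n →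
      1 / 2 < (iidLaw Q).real (T.overshoot n) := by
  obtain ⟨δ, hδ, hδ₁, hδ₂⟩ : ∃ δ : ℝ, 0 < δ ∧ relEntropy Q P₁ < E.1 - δ ∧
      relEntropy Q P₂ < E.2 - δ := by
    obtain ⟨δ, hδ, hδ'⟩ := exists_between (lt_min (sub_pos.2 hE₁) (sub_pos.2 hE₂))
    rw [lt_min_iff] at hδ'
    exact ⟨δ, hδ, by linarith, by linarith⟩
  obtain ⟨N₁, hN₁⟩ := exists_forall_iidLaw_real_lt h₁ hδ₁ (ε := 1 / 4) (by norm_num)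
  obtain ⟨N₂, hN₂⟩ := exists_forall_iidLaw_real_lt h₂ hδ₂ (ε := 1 / 4) (by norm_num)
  refine ⟨δ, hδ, max N₁ N₂, fun n hn T hT => ?_⟩
  -- The decision may use samples after time `n`; only its intersection with `τ ≤ n` is determined
  -- by the first `n`.
  have hA₁ := (T.isStoppingTime.measurableSet _).1 T.measurable_acceptOne
  have hA₂ := (T.isStoppingTime.measurableSet _).1 T.measurable_acceptOne.compl
  have b₁ : (iidLaw Q).real (T.acceptOneᶜ ∩ {ω | T.τ ω ≤ (n : WithTop ℕ)}) < 1 / 4 :=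
    hN₁ n ((le_max_left _ _).trans hn) _ (hA₂.2 n)
      ((measureReal_mono inter_subset_left).trans hT.1)
  have b₂ : (iidLaw Q).real (T.acceptOne ∩ {ω | T.τ ω ≤ (n : WithTop ℕ)}) < 1 / 4 :=
    hN₂ n ((le_max_right _ _).trans hn) _ (hA₁.2 n)
      ((measureReal_mono inter_subset_left).trans hT.2)
  have hcov : (univ : Set (ℕ → X)) ⊆ (T.acceptOneᶜ ∩ {ω | T.τ ω ≤ n}) ∪
      ((T.acceptOne ∩ {ω | T.τ ω ≤ n}) ∪ T.overshoot n) := by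
    intro ω _
    by_cases h : T.τ ω ≤ n
    · by_cases h' : ω ∈ T.acceptOne
      · exact Or.inr (Or.inl ⟨h', h⟩)
      · exact Or.inl ⟨h', h⟩
    · exact Or.inr (Or.inr (not_le.1 h))
  have h := (measureReal_mono (μ := iidLaw Q) hcov).trans
    ((measureReal_union_le _ _).trans (add_le_add le_rfl (measureReal_union_le _ _)))
  rw [probReal_univ] at h
  linarith

/-- The overshoot event is null, so any exponent `γ` is allowed; the fixed-length converse thus
becomes a special case. -/
lemma regionFL_subset_regionAFL (γ : ℝ) : regionFL P₁ P₂ ⊆ regionAFL P₁ P₂ γ 1 := by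
  intro E hE δ hδ
  obtain ⟨N, hN⟩ := hE δ hδ
  refine ⟨N, fun n hn => ?_⟩
  obtain ⟨T, hT, hT'⟩ := hN n hn
  have h0 : ∀ μ : Measure (ℕ → X), (∀ᵐ ω ∂μ, T.τ ω ≤ n) → μ.real (T.overshoot n) = 0 := by
    intro μ hμ
    have : μ (T.overshoot n) = 0 := by
      rw [← nonpos_iff_eq_zero, ← ae_iff.1 hμ]
      exact measure_mono fun ω hω => not_le.2 hω
    simp [measureReal_def, this]
  refine ⟨T, ⟨?_, ?_⟩, by rwa [one_mul], hT'⟩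
  · rw [h0 _ hT.1]; positivity
  · rw [h0 _ hT.2]; positivity

variable [Fintype X] [MeasurableSingletonClass X]

/-- A distribution whose divergences from `P₁` and `P₂` lie below the exponents makes the test
overshoot, so neither divergence can lie below the overshoot exponent `γ`. -/
lemma le_relEntropy_of_mem_regionAFL {γ : ℝ} {K : ℕ} {E : ℝ × ℝ} (hE : E ∈ regionAFL P₁ P₂ γ K)
    {Q : Measure X} [IsProbabilityMeasure Q] (h₁ : Q ≪ P₁) (h₂ : Q ≪ P₂)
    (hE₁ : relEntropy Q P₁ < E.1) (hE₂ : relEntropy Q P₂ < E.2) :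
    γ ≤ relEntropy Q P₁ ∧ γ ≤ relEntropy Q P₂ := by
  obtain ⟨δ, hδ, N, hN⟩ := exists_forall_half_lt_overshoot h₁ h₂ hE₁ hE₂
  obtain ⟨N', hN'⟩ := hE δ hδ
  constructor
  · by_contra! hγ
    obtain ⟨M, hM⟩ := exists_forall_iidLaw_real_lt h₁ hγ (ε := 1 / 2) (by norm_num)
    obtain ⟨T, hT, -, hT'⟩ := hN' (N + N' + M) (by omega)
    have a := hN _ (by omega) T hT'
    have b := hM _ (by omega) _ (T.measurableSet_overshoot _) hT.1
    linarith
  · by_contra! hγ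
    obtain ⟨M, hM⟩ := exists_forall_iidLaw_real_lt h₂ hγ (ε := 1 / 2) (by norm_num)
    obtain ⟨T, hT, -, hT'⟩ := hN' (N + N' + M) (by omega)
    have a := hN _ (by omega) T hT'
    have b := hM _ (by omega) _ (T.measurableSet_overshoot _) hT.2
    linarith

lemma le_relEntropy_or_of_mem_regionFL {E : ℝ × ℝ} (hE : E ∈ regionFL P₁ P₂)
    {Q : Measure X} [IsProbabilityMeasure Q] (h₁ : Q ≪ P₁) (h₂ : Q ≪ P₂) :
    E.1 ≤ relEntropy Q P₁ ∨ E.2 ≤ relEntropy Q P₂ := by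
  by_contra! h
  have := (le_relEntropy_of_mem_regionAFL (regionFL_subset_regionAFL (relEntropy Q P₁ + 1) hE)
    h₁ h₂ h.1 h.2).1
  linarith

/-- The tests of a pair in `regionVanishing` stop in time with high probability under both
hypotheses, so the converse applies with `Q` equal to either hypothesis. -/
lemma le_relEntropy_or_of_mem_regionVanishing {K : ℕ} {E : ℝ × ℝ}
    (hE : E ∈ regionVanishing P₁ P₂ K) {Q : Measure X} [IsProbabilityMeasure Q]
    (h₁ : Q ≪ P₁) (h₂ : Q ≪ P₂) (hQ : Q = P₁ ∨ Q = P₂) :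
    E.1 ≤ relEntropy Q P₁ ∨ E.2 ≤ relEntropy Q P₂ := by
  by_contra! h
  obtain ⟨δ, hδ, N, hN⟩ := exists_forall_half_lt_overshoot h₁ h₂ h.1 h.2
  -- The same parameter bounds the overshoot and the loss in the exponents, so it has to be small
  -- enough for both.
  obtain ⟨N', hN'⟩ := hE (min δ (1 / 2)) (by positivity)
  obtain ⟨T, hT, -, hT'⟩ := hN' (N + N') (by omega)
  have a := hN _ (by omega) T (hT'.mono (min_le_left _ _))
  have hm := min_le_right δ (1 / 2)
  rcases hQ with rfl | rfl
  · linarith [hT.1]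
  · linarith [hT.2]

end Converse

/-! ### Divergence and Chernoff bounds on a finite set -/

section FiniteMeasures

variable {X : Type*} [MeasurableSpace X] [Fintype X]

lemma absolutelyContinuous_of_singleton {P Q : Measure X} (h : ∀ x, P {x} = 0 → Q {x} = 0) :
    Q ≪ P := fun s hs =>
  (measure_null_iff_singleton s.to_countable).2 fun x hx =>
    h x (measure_mono_null (singleton_subset_iff.2 hx) hs)

lemma relEntropy_self (P : Measure X) : relEntropy P P = 0 := by
  refine Finset.sum_eq_zero fun x _ => ?_
  by_cases h : P.real {x} = 0 <;> simp [h]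

variable [MeasurableSingletonClass X]

lemma klDiv_eq_ofReal_relEntropy {P Q : Measure X} [IsProbabilityMeasure P]
    [IsProbabilityMeasure Q] (h : Q ≪ P) :
    ((InformationTheory.klDiv Q P : ℝ≥0∞) : EReal) = (relEntropy Q P : ℝ) := by
  have hint : Integrable (llr Q P) Q := Integrable.of_finite
  have hreal : (InformationTheory.klDiv Q P).toReal = relEntropy Q P := by
    rw [InformationTheory.toReal_klDiv_of_measure_eq h (by simp), integral_fintype hint]
    refine Finset.sum_congr rfl fun x _ => ?_
    by_cases hx : P {x} = 0
    · simp [measureReal_def, h hx]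
    · have h1 : Q.rnDeriv P x * P {x} = Q {x} := by
        rw [← lintegral_singleton, ← withDensity_apply _ (measurableSet_singleton x),
          Measure.withDensity_rnDeriv_eq Q P h]
      have hx' : P.real {x} ≠ 0 := by simpa [measureReal_eq_zero_iff] using hx
      have h2 : (Q.rnDeriv P x).toReal = Q.real {x} / P.real {x} := by
        rw [eq_div_iff hx', measureReal_def, measureReal_def, ← ENNReal.toReal_mul, h1]
      rw [llr, h2, smul_eq_mul]
  rw [← hreal, ← ENNReal.ofReal_toReal (InformationTheory.klDiv_ne_top h hint),
    EReal.coe_ennreal_ofReal, max_eq_left ENNReal.toReal_nonneg,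
    ENNReal.toReal_ofReal ENNReal.toReal_nonneg]

variable {P Q : Measure X} [IsProbabilityMeasure Q] {f : X → ℝ} {c ζ : ℝ}

/-- The log-density is affine in `f`, so the divergence depends only on the mean of `f` under `Q`.
This yields both the continuity of the divergences along the tilted path and the Chernoff exponent.
-/
lemma relEntropy_of_exponential (hQ : ∀ x, Q.real {x} = P.real {x} * Real.exp (c * f x - ζ)) :
    relEntropy Q P = c * (∑ x, Q.real {x} * f x) - ζ := by
  have h1 : ∑ x, Q.real {x} = 1 := by simp
  have h2 : relEntropy Q P = ∑ x, Q.real {x} * (c * f x - ζ) := by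
    refine Finset.sum_congr rfl fun x _ => ?_
    by_cases hx : P.real {x} = 0
    · simp [hQ, hx]
    · rw [hQ x, mul_div_cancel_left₀ _ hx, Real.log_exp]
  rw [h2]
  calc ∑ x, Q.real {x} * (c * f x - ζ)
      = c * (∑ x, Q.real {x} * f x) - (∑ x, Q.real {x}) * ζ := by
        rw [Finset.mul_sum, Finset.sum_mul, ← Finset.sum_sub_distrib]
        exact Finset.sum_congr rfl fun x _ => by ring
    _ = _ := by rw [h1, one_mul]

/-- The Chernoff bound for a half-space of empirical means of an exponential family. -/
lemma iidLaw_real_le_exp_neg_relEntropy [IsProbabilityMeasure P]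
    (hQ : ∀ x, Q.real {x} = P.real {x} * Real.exp (c * f x - ζ)) {n : ℕ} {B : Set (ℕ → X)}
    (hB : MeasurableSet[sampleFiltration X n] B)
    (h : ∀ ω ∈ B, c * (n * ∑ x, Q.real {x} * f x) ≤ c * ∑ k ∈ Finset.range n, f (ω k)) :
    (iidLaw P).real B ≤ Real.exp (-relEntropy Q P * n) := by
  -- On `B` the likelihood ratio of `Q` to `P` is at least `e^{nD(Q‖P)}`, and `Q` gives `B` mass at
  -- most one.
  refine (iidLaw_real_le_mul Q P hB (M := Real.exp (-relEntropy Q P * n)) fun ω hω => ?_).trans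
    (mul_le_of_le_one_right (Real.exp_pos _).le measureReal_le_one)
  have hprod : ∏ k ∈ Finset.range n, Q.real {ω k} =
      (∏ k ∈ Finset.range n, P.real {ω k}) *
        Real.exp (c * ∑ k ∈ Finset.range n, f (ω k) - n * ζ) := by
    rw [Finset.prod_congr rfl fun k _ => hQ (ω k), Finset.prod_mul_distrib, ← Real.exp_sum,
      Finset.sum_sub_distrib, ← Finset.mul_sum]
    simp
  rw [hprod, mul_left_comm, ← Real.exp_add]
  refine le_mul_of_one_le_right (Finset.prod_nonneg fun _ _ => measureReal_nonneg)
    (Real.one_le_exp ?_)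
  rw [relEntropy_of_exponential hQ]
  linarith [h ω hω]

end FiniteMeasures

/-! ### The tilted path as an exponential family -/

section Tilted

variable {X : Type*} [MeasurableSpace X] (P₁ P₂ : Measure X)

/-- The log-likelihood ratio of one sample. -/
noncomputable def logRatio (x : X) : ℝ := Real.log (P₂.real {x} / P₁.real {x})

variable {P₁ P₂} in
lemma real_mul_exp_logRatio [IsProbabilityMeasure P₁] [IsProbabilityMeasure P₂] (h₁₂ : P₁ ≪ P₂)
    (h₂₁ : P₂ ≪ P₁) (x : X) :
    P₁.real {x} * Real.exp (logRatio P₁ P₂ x) = P₂.real {x} := by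
  by_cases h : P₁ {x} = 0
  · simp [measureReal_def, h, h₂₁ h]
  · have h' : P₂ {x} ≠ 0 := fun h0 => h (h₁₂ h0)
    have a : 0 < P₁.real {x} := ENNReal.toReal_pos h (measure_ne_top _ _)
    have b : 0 < P₂.real {x} := ENNReal.toReal_pos h' (measure_ne_top _ _)
    rw [logRatio, Real.exp_log (by positivity), mul_div_cancel₀ _ a.ne']

variable {P₁ P₂} in
lemma tiltedWeight_eq_ofReal [IsProbabilityMeasure P₁] [IsProbabilityMeasure P₂] (h₁₂ : P₁ ≪ P₂)
    (h₂₁ : P₂ ≪ P₁) (l : ℝ) (x : X) :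
    tiltedWeight P₁ P₂ l x = ENNReal.ofReal (P₁.real {x} * Real.exp (l * logRatio P₁ P₂ x)) := by
  by_cases h : P₁ {x} = 0
  · have h0 : P₁.real {x} = 0 := by simp [measureReal_def, h]
    rw [tiltedWeight, h, h₂₁ h, h0, zero_mul, ENNReal.ofReal_zero]
    -- At a common null point `0 ^ 0 = 1` is harmless: `l` and `1 - l` are not both nonpositive, so
    -- some factor is zero.
    rcases lt_or_ge 0 l with hl | hl
    · rw [ENNReal.zero_rpow_of_pos hl, mul_zero]
    · rw [ENNReal.zero_rpow_of_pos (by linarith), zero_mul]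
  · have h' : P₂ {x} ≠ 0 := fun h0 => h (h₁₂ h0)
    have a : 0 < P₁.real {x} := ENNReal.toReal_pos h (measure_ne_top _ _)
    have b : 0 < P₂.real {x} := ENNReal.toReal_pos h' (measure_ne_top _ _)
    rw [tiltedWeight, ← ofReal_measureReal (μ := P₁), ← ofReal_measureReal (μ := P₂),
      ENNReal.ofReal_rpow_of_pos a, ENNReal.ofReal_rpow_of_pos b,
      ← ENNReal.ofReal_mul (by positivity), ← real_mul_exp_logRatio h₁₂ h₂₁ x,
      Real.mul_rpow a.le (Real.exp_pos _).le, ← Real.exp_mul, ← mul_assoc, ← Real.rpow_add a]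
    simp [mul_comm]

variable [Fintype X]

/-- The normalizing constant of the tilted distribution. -/
noncomputable def partition (l : ℝ) : ℝ := ∑ x, P₁.real {x} * Real.exp (l * logRatio P₁ P₂ x)

variable {P₁ P₂} in
lemma continuous_partition : Continuous (partition P₁ P₂) := by
  unfold partition; fun_prop

lemma partition_pos [MeasurableSingletonClass X] [IsProbabilityMeasure P₁] (l : ℝ) : 0 < partition P₁ P₂ l := by
  obtain ⟨x, hx⟩ : ∃ x, P₁.real {x} ≠ 0 := by
    by_contra! h
    have h1 : ∑ x, P₁.real {x} = 1 := by simp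
    simp [h] at h1
  refine Finset.sum_pos' (fun x _ => mul_nonneg measureReal_nonneg (Real.exp_pos _).le)
    ⟨x, Finset.mem_univ _, mul_pos (lt_of_le_of_ne measureReal_nonneg hx.symm) (Real.exp_pos _)⟩

variable {P₁ P₂} [IsProbabilityMeasure P₁] [IsProbabilityMeasure P₂]
  [MeasurableSingletonClass X]

lemma tilted_singleton (h₁₂ : P₁ ≪ P₂) (h₂₁ : P₂ ≪ P₁) (l : ℝ) (x : X) :
    tilted P₁ P₂ l {x} = ENNReal.ofReal
      (P₁.real {x} * Real.exp (l * logRatio P₁ P₂ x - Real.log (partition P₁ P₂ l))) := by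
  have hZ := partition_pos P₁ P₂ l
  have hw : ∀ x, 0 ≤ P₁.real {x} * Real.exp (l * logRatio P₁ P₂ x) := fun x =>
    mul_nonneg measureReal_nonneg (Real.exp_pos _).le
  have h1 : tilted P₁ P₂ l {x} =
      tiltedWeight P₁ P₂ l x / ∑ a : X, tiltedWeight P₁ P₂ l a := by
    classical
    simp only [tilted, Measure.coe_finsetSum, Finset.sum_apply, Measure.smul_apply, smul_eq_mul,
      Measure.dirac_apply' _ (measurableSet_singleton x)]
    rw [Finset.sum_eq_single x]
    · simp
    · intro b _ hb
      simp [hb]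
    · simp
  rw [h1]
  simp only [tiltedWeight_eq_ofReal h₁₂ h₂₁]
  rw [← ENNReal.ofReal_sum_of_nonneg fun x _ => hw x, ← partition, ← ENNReal.ofReal_div_of_pos hZ,
    Real.exp_sub, Real.exp_log hZ, mul_div_assoc]

lemma tilted_real_singleton (h₁₂ : P₁ ≪ P₂) (h₂₁ : P₂ ≪ P₁) (l : ℝ) (x : X) :
    (tilted P₁ P₂ l).real {x} =
      P₁.real {x} * Real.exp (l * logRatio P₁ P₂ x - Real.log (partition P₁ P₂ l)) := by
  rw [measureReal_def, tilted_singleton h₁₂ h₂₁, ENNReal.toReal_ofReal]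
  exact mul_nonneg measureReal_nonneg (Real.exp_pos _).le

/-- Seen from `P₂` the coefficient is `l - 1`, which is nonpositive on `[0,1]`: the Chernoff bound
then concerns the opposite half-space. -/
lemma tilted_real_singleton' (h₁₂ : P₁ ≪ P₂) (h₂₁ : P₂ ≪ P₁) (l : ℝ) (x : X) :
    (tilted P₁ P₂ l).real {x} =
      P₂.real {x} * Real.exp ((l - 1) * logRatio P₁ P₂ x - Real.log (partition P₁ P₂ l)) := by
  rw [tilted_real_singleton h₁₂ h₂₁, ← real_mul_exp_logRatio h₁₂ h₂₁ x, mul_assoc, ← Real.exp_add]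
  ring_nf

lemma isProbabilityMeasure_tilted (h₁₂ : P₁ ≪ P₂) (h₂₁ : P₂ ≪ P₁) (l : ℝ) :
    IsProbabilityMeasure (tilted P₁ P₂ l) := by
  have hZ := partition_pos P₁ P₂ l
  constructor
  rw [← Finset.coe_univ, ← sum_measure_singleton]
  simp only [tilted_singleton h₁₂ h₂₁, Real.exp_sub, Real.exp_log hZ, ← mul_div_assoc]
  rw [← ENNReal.ofReal_sum_of_nonneg
    fun x _ => div_nonneg (mul_nonneg measureReal_nonneg (Real.exp_pos _).le) hZ.le,
    ← Finset.sum_div, ← partition, div_self hZ.ne', ENNReal.ofReal_one]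

lemma tilted_absolutelyContinuous (h₁₂ : P₁ ≪ P₂) (h₂₁ : P₂ ≪ P₁) (l : ℝ) :
    tilted P₁ P₂ l ≪ P₁ :=
  absolutelyContinuous_of_singleton fun x hx => by
    rw [tilted_singleton h₁₂ h₂₁]
    simp [measureReal_def, hx]

lemma tilted_zero (h₁₂ : P₁ ≪ P₂) (h₂₁ : P₂ ≪ P₁) : tilted P₁ P₂ 0 = P₁ := by
  refine Measure.ext_of_singleton fun x => ?_
  rw [tilted_singleton h₁₂ h₂₁]
  simp [partition]

lemma tilted_one (h₁₂ : P₁ ≪ P₂) (h₂₁ : P₂ ≪ P₁) : tilted P₁ P₂ 1 = P₂ := by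
  refine Measure.ext_of_singleton fun x => ?_
  rw [tilted_singleton h₁₂ h₂₁]
  simp [partition, real_mul_exp_logRatio h₁₂ h₂₁]

lemma divTilted_one_eq (h₁₂ : P₁ ≪ P₂) (h₂₁ : P₂ ≪ P₁) (l : ℝ) :
    divTilted P₁ P₂ l P₁ = (relEntropy (tilted P₁ P₂ l) P₁ : ℝ) :=
  have := isProbabilityMeasure_tilted h₁₂ h₂₁ l
  klDiv_eq_ofReal_relEntropy (tilted_absolutelyContinuous h₁₂ h₂₁ l)

lemma divTilted_two_eq (h₁₂ : P₁ ≪ P₂) (h₂₁ : P₂ ≪ P₁) (l : ℝ) :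
    divTilted P₁ P₂ l P₂ = (relEntropy (tilted P₁ P₂ l) P₂ : ℝ) :=
  have := isProbabilityMeasure_tilted h₁₂ h₂₁ l
  klDiv_eq_ofReal_relEntropy ((tilted_absolutelyContinuous h₁₂ h₂₁ l).trans h₁₂)

lemma continuous_tilted_mean (h₁₂ : P₁ ≪ P₂) (h₂₁ : P₂ ≪ P₁) :
    Continuous fun l => ∑ x, (tilted P₁ P₂ l).real {x} * logRatio P₁ P₂ x := by
  simp only [tilted_real_singleton h₁₂ h₂₁]
  have := (continuous_partition (P₁ := P₁) (P₂ := P₂)).log fun l => (partition_pos P₁ P₂ l).ne'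
  fun_prop

lemma continuous_relEntropy_tilted_one (h₁₂ : P₁ ≪ P₂) (h₂₁ : P₂ ≪ P₁) :
    Continuous fun l => relEntropy (tilted P₁ P₂ l) P₁ := by
  have h : ∀ l, relEntropy (tilted P₁ P₂ l) P₁ =
      l * (∑ x, (tilted P₁ P₂ l).real {x} * logRatio P₁ P₂ x) - Real.log (partition P₁ P₂ l) :=
    fun l =>
      have := isProbabilityMeasure_tilted h₁₂ h₂₁ l
      relEntropy_of_exponential (tilted_real_singleton h₁₂ h₂₁ l)
  simp only [h]
  exact (continuous_id.mul (continuous_tilted_mean h₁₂ h₂₁)).sub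
    (continuous_partition.log fun l => (partition_pos P₁ P₂ l).ne')

lemma continuous_relEntropy_tilted_two (h₁₂ : P₁ ≪ P₂) (h₂₁ : P₂ ≪ P₁) :
    Continuous fun l => relEntropy (tilted P₁ P₂ l) P₂ := by
  have h : ∀ l, relEntropy (tilted P₁ P₂ l) P₂ =
      (l - 1) * (∑ x, (tilted P₁ P₂ l).real {x} * logRatio P₁ P₂ x) -
        Real.log (partition P₁ P₂ l) :=
    fun l =>
      have := isProbabilityMeasure_tilted h₁₂ h₂₁ l
      relEntropy_of_exponential (tilted_real_singleton' h₁₂ h₂₁ l)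
  simp only [h]
  exact ((continuous_id.sub continuous_const).mul (continuous_tilted_mean h₁₂ h₂₁)).sub
    (continuous_partition.log fun l => (partition_pos P₁ P₂ l).ne')

end Tilted

/-! ### Comparison of the achievable regions -/

section Regions

variable {X : Type*} [MeasurableSpace X]

/-- The test that decides at the fixed time `n`. -/
def fixedLengthTest (n : ℕ) (A : Set (ℕ → X)) (hA : MeasurableSet[sampleFiltration X n] A) :
    HypothesisTest X where
  τ := fun _ => (n : WithTop ℕ)
  isStoppingTime := isStoppingTime_const _ n
  acceptOne := A
  measurable_acceptOne := by
    have h := IsStoppingTime.measurableSpace_const (sampleFiltration X) n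
    rw [← h] at hA
    exact hA

variable {P₁ P₂ : Measure X} [IsProbabilityMeasure P₁] [IsProbabilityMeasure P₂]

/-- A test that ignores the data makes one error zero, and a nonpositive exponent puts no constraint
on the other. -/
lemma mem_regionFL_of_nonpos {E : ℝ × ℝ} (hE : E.1 ≤ 0 ∨ E.2 ≤ 0) : E ∈ regionFL P₁ P₂ := by
  intro δ hδ
  refine ⟨0, fun n _ => ?_⟩
  have hn : (0 : ℝ) ≤ n := n.cast_nonneg
  have hexp : ∀ e : ℝ, e ≤ 0 → 1 ≤ Real.exp (-(e - δ) * n) := fun e he =>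
    Real.one_le_exp (mul_nonneg (by linarith) hn)
  rcases hE with h | h
  · refine ⟨fixedLengthTest n ∅ (@MeasurableSet.empty _ (sampleFiltration X n)),
      ⟨Eventually.of_forall fun _ => le_rfl, Eventually.of_forall fun _ => le_rfl⟩,
      measureReal_le_one.trans (hexp _ h), ?_⟩
    simp [fixedLengthTest, Real.exp_nonneg]
  · refine ⟨fixedLengthTest n univ (@MeasurableSet.univ _ (sampleFiltration X n)),
      ⟨Eventually.of_forall fun _ => le_rfl, Eventually.of_forall fun _ => le_rfl⟩,
      ?_, measureReal_le_one.trans (hexp _ h)⟩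
    simp [fixedLengthTest, HypothesisTest.acceptTwo, Real.exp_nonneg]

/-- Tests bounded by `K n` with exponents `E` at scale `n` have exponents `E / K` at
scale `K n`. -/
lemma mem_smul_regionFL {K : ℕ} (hK : 1 ≤ K) {E : ℝ × ℝ}
    (hE : ∀ δ : ℝ, 0 < δ → ∃ N : ℕ, ∀ n : ℕ, N ≤ n → ∃ T : HypothesisTest X,
      T.BoundedBy P₁ P₂ (K * n) ∧ T.ErrorsLE P₁ P₂ E δ n) :
    E ∈ (K : ℝ) • regionFL P₁ P₂ := by
  have hK0 : (0 : ℝ) < K := by exact_mod_cast hK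
  have hK1 : (1 : ℝ) ≤ K := by exact_mod_cast hK
  rw [mem_smul_set_iff_inv_smul_mem₀ hK0.ne']
  by_cases hpos : E.1 ≤ 0 ∨ E.2 ≤ 0
  · refine mem_regionFL_of_nonpos (hpos.imp ?_ ?_) <;>
    · intro h
      exact mul_nonpos_of_nonneg_of_nonpos (inv_nonneg.2 hK0.le) h
  push Not at hpos
  intro δ hδ
  -- Keeping `δ'` below both exponents makes `e - δ'` positive, so a lower bound on the floor `m /
  -- K` can be used. The bound by `δ / 2` leaves the other half for rounding.
  obtain ⟨δ', hδ', hlt⟩ := exists_between (lt_min (half_pos hδ) (lt_min hpos.1 hpos.2))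
  simp only [lt_min_iff] at hlt
  obtain ⟨N, hN⟩ := hE δ' hδ'
  -- Rounding `m / K` down costs at most `e ≤ E₁ + E₂` in the exponent, which is at most `δ m / 2`
  -- once `m ≥ M`.
  obtain ⟨M, hM⟩ := exists_nat_ge (2 * (E.1 + E.2) / δ)
  rw [div_le_iff₀ hδ] at hM
  refine ⟨max M (K * N), fun m hm => ?_⟩
  obtain ⟨T, hT, hT'⟩ := hN (m / K) ((Nat.le_div_iff_mul_le hK).2
    (by rw [mul_comm]; exact (le_max_right _ _).trans hm))
  have hmul : K * (m / K) ≤ m := Nat.mul_div_le m K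
  have hmM : (M : ℝ) ≤ m := by exact_mod_cast (le_max_left _ _).trans hm
  have hdiv : (m : ℝ) / K - 1 ≤ ((m / K : ℕ) : ℝ) := by
    have h := Nat.lt_mul_div_succ m (show 0 < K from hK)
    have h' : (m : ℝ) < K * ((m / K : ℕ) + 1) := by exact_mod_cast h
    rw [sub_le_iff_le_add, div_le_iff₀ hK0]
    linarith
  have key : ∀ e : ℝ, δ' < e → e ≤ E.1 + E.2 →
      Real.exp (-(e - δ') * ((m / K : ℕ) : ℝ)) ≤ Real.exp (-((K : ℝ)⁻¹ * e - δ) * m) := by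
    intro e he he'
    refine Real.exp_le_exp.2 ?_
    have h1 : (e - δ') * ((m : ℝ) / K - 1) ≤ (e - δ') * ((m / K : ℕ) : ℝ) :=
      mul_le_mul_of_nonneg_left hdiv (by linarith)
    have h2 : (m : ℝ) / K ≤ m := div_le_self m.cast_nonneg hK1
    have h3 : δ' * ((m : ℝ) / K) ≤ δ / 2 * m :=
      mul_le_mul hlt.1.le h2 (by positivity) (by linarith)
    have h4 : (K : ℝ)⁻¹ * e * m = e * (m / K) := by ring
    have h5 : M * δ ≤ m * δ := mul_le_mul_of_nonneg_right hmM hδ.le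
    linarith
  refine ⟨T, ⟨hT.1.mono fun ω h => h.trans (by exact_mod_cast hmul),
    hT.2.mono fun ω h => h.trans (by exact_mod_cast hmul)⟩, hT'.1.trans ?_, hT'.2.trans ?_⟩
  · exact key E.1 hlt.2.1 (by linarith [hpos.2])
  · exact key E.2 hlt.2.2 (by linarith [hpos.1])

lemma regionAFL_subset_smul {γ : ℝ} {K : ℕ} (hK : 1 ≤ K) :
    regionAFL P₁ P₂ γ K ⊆ (K : ℝ) • regionFL P₁ P₂ := fun _ hE =>
  mem_smul_regionFL hK fun δ hδ =>
    (hE δ hδ).imp fun _ hN n hn => (hN n hn).imp fun _ hT => hT.2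

lemma regionVanishing_subset_smul {K : ℕ} (hK : 1 ≤ K) :
    regionVanishing P₁ P₂ K ⊆ (K : ℝ) • regionFL P₁ P₂ := fun _ hE =>
  mem_smul_regionFL hK fun δ hδ =>
    (hE δ hδ).imp fun _ hN n hn => (hN n hn).imp fun _ hT => hT.2

variable [Fintype X] [MeasurableSingletonClass X]

lemma mem_regionTilted_iff (h₁₂ : P₁ ≪ P₂) (h₂₁ : P₂ ≪ P₁) {E : ℝ × ℝ} :
    E ∈ regionTilted P₁ P₂ ↔ ∃ l ∈ Icc (0 : ℝ) 1,
      E.1 ≤ relEntropy (tilted P₁ P₂ l) P₁ ∧ E.2 ≤ relEntropy (tilted P₁ P₂ l) P₂ := by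
  simp only [regionTilted, mem_ofPred_eq, divTilted_one_eq h₁₂ h₂₁, divTilted_two_eq h₁₂ h₂₁,
    EReal.coe_le_coe_iff]

lemma le_maxExponentOne (h₁₂ : P₁ ≪ P₂) (h₂₁ : P₂ ≪ P₁) {γ e l : ℝ} (hl : l ∈ Icc (0 : ℝ) 1)
    (hγ : γ ≤ relEntropy (tilted P₁ P₂ l) P₂) (he : e ≤ relEntropy (tilted P₁ P₂ l) P₁) :
    (e : EReal) ≤ maxExponentOne P₁ P₂ γ := by
  refine le_trans ?_ (le_sSup ⟨l, hl, ?_, rfl⟩)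
  · rw [divTilted_one_eq h₁₂ h₂₁]; exact_mod_cast he
  · rw [divTilted_two_eq h₁₂ h₂₁]; exact_mod_cast hγ

lemma le_maxExponentTwo (h₁₂ : P₁ ≪ P₂) (h₂₁ : P₂ ≪ P₁) {γ e l : ℝ} (hl : l ∈ Icc (0 : ℝ) 1)
    (hγ : γ ≤ relEntropy (tilted P₁ P₂ l) P₁) (he : e ≤ relEntropy (tilted P₁ P₂ l) P₂) :
    (e : EReal) ≤ maxExponentTwo P₁ P₂ γ := by
  refine le_trans ?_ (le_sSup ⟨l, hl, ?_, rfl⟩)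
  · rw [divTilted_two_eq h₁₂ h₂₁]; exact_mod_cast he
  · rw [divTilted_one_eq h₁₂ h₂₁]; exact_mod_cast hγ

/-- Comparing the empirical mean of the log-likelihood ratio with its mean under a tilted
distribution achieves the divergences of that distribution as exponents. -/
lemma regionTilted_subset_regionFL (h₁₂ : P₁ ≪ P₂) (h₂₁ : P₂ ≪ P₁) :
    regionTilted P₁ P₂ ⊆ regionFL P₁ P₂ := by
  intro E hE
  obtain ⟨l, hl, hE₁, hE₂⟩ := (mem_regionTilted_iff h₁₂ h₂₁).1 hE
  have := isProbabilityMeasure_tilted h₁₂ h₂₁ l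
  intro δ hδ
  refine ⟨0, fun n _ => ?_⟩
  have hn : (0 : ℝ) ≤ n := n.cast_nonneg
  set t : ℝ := ∑ x, (tilted P₁ P₂ l).real {x} * logRatio P₁ P₂ x
  set A : Set (ℕ → X) := {ω | ∑ k ∈ Finset.range n, logRatio P₁ P₂ (ω k) < n * t} with hA_def
  have hA : MeasurableSet[sampleFiltration X n] A :=
    @measurableSet_lt _ _ _ _ _ (sampleFiltration X n) _ _ _ _ _
      (measurable_sum_samples n (logRatio P₁ P₂)) measurable_const
  refine ⟨fixedLengthTest n A hA,
    ⟨Eventually.of_forall fun _ => le_rfl, Eventually.of_forall fun _ => le_rfl⟩, ?_, ?_⟩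
  -- One threshold serves both errors: `0 ≤ l` gives the upper half-space under `P₁`, and `l - 1 ≤
  -- 0` the lower one under `P₂`.
  · refine (iidLaw_real_le_exp_neg_relEntropy (tilted_real_singleton h₁₂ h₂₁ l) hA.compl
      fun ω hω => mul_le_mul_of_nonneg_left (not_lt.1 hω) hl.1).trans (Real.exp_le_exp.2 ?_)
    exact mul_le_mul_of_nonneg_right (by linarith) hn
  · refine (iidLaw_real_le_exp_neg_relEntropy (tilted_real_singleton' h₁₂ h₂₁ l) hA
      fun ω hω => mul_le_mul_of_nonpos_left (le_of_lt hω) (by linarith [hl.2])).trans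
      (Real.exp_le_exp.2 ?_)
    exact mul_le_mul_of_nonneg_right (by linarith) hn

/-- Two closed conditions cover the connected path, and positivity of the exponents puts an endpoint
in each, so they hold together somewhere. -/
lemma mem_regionTilted_of_mem_regionFL (h₁₂ : P₁ ≪ P₂) (h₂₁ : P₂ ≪ P₁) {E : ℝ × ℝ}
    (hE : E ∈ regionFL P₁ P₂) (hE₁ : 0 < E.1) (hE₂ : 0 < E.2) : E ∈ regionTilted P₁ P₂ := by
  rw [mem_regionTilted_iff h₁₂ h₂₁]
  have hcov : ∀ l, E.1 ≤ relEntropy (tilted P₁ P₂ l) P₁ ∨ E.2 ≤ relEntropy (tilted P₁ P₂ l) P₂ :=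
    fun l =>
      have := isProbabilityMeasure_tilted h₁₂ h₂₁ l
      le_relEntropy_or_of_mem_regionFL hE (tilted_absolutelyContinuous h₁₂ h₂₁ l)
        ((tilted_absolutelyContinuous h₁₂ h₂₁ l).trans h₁₂)
  have h0 := (hcov 0).resolve_left (by rw [tilted_zero h₁₂ h₂₁, relEntropy_self]; exact hE₁.not_ge)
  have h1 := (hcov 1).resolve_right (by rw [tilted_one h₁₂ h₂₁, relEntropy_self]; exact hE₂.not_ge)
  obtain ⟨l, hl, hl'⟩ := isPreconnected_closed_iff.1 (isPreconnected_Icc (a := (0 : ℝ)) (b := 1))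
    {l | E.1 ≤ relEntropy (tilted P₁ P₂ l) P₁} {l | E.2 ≤ relEntropy (tilted P₁ P₂ l) P₂}
    (isClosed_le continuous_const (continuous_relEntropy_tilted_one h₁₂ h₂₁))
    (isClosed_le continuous_const (continuous_relEntropy_tilted_two h₁₂ h₂₁))
    (fun l _ => hcov l) ⟨1, by simp, h1⟩ ⟨0, by simp, h0⟩
  exact ⟨l, hl, hl'⟩

lemma regionAFL_subset_regionGamma (h₁₂ : P₁ ≪ P₂) (h₂₁ : P₂ ≪ P₁) {γ : ℝ} (hγ : 0 < γ) (K : ℕ) :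
    regionAFL P₁ P₂ γ K ⊆ regionGamma P₁ P₂ γ := by
  intro E hE
  by_cases hpos : E.1 ≤ 0 ∨ E.2 ≤ 0
  · exact Or.inl (mem_regionFL_of_nonpos hpos)
  push Not at hpos
  by_cases hT : E ∈ regionTilted P₁ P₂
  · exact Or.inl (regionTilted_subset_regionFL h₁₂ h₂₁ hT)
  rw [mem_regionTilted_iff h₁₂ h₂₁] at hT
  push Not at hT
  set S₁ : Set ℝ := {l | E.1 ≤ relEntropy (tilted P₁ P₂ l) P₁} with hS₁
  set S₂ : Set ℝ := {l | E.2 ≤ relEntropy (tilted P₁ P₂ l) P₂} with hS₂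
  set S₃ : Set ℝ := {l | γ ≤ relEntropy (tilted P₁ P₂ l) P₁} ∩
    {l | γ ≤ relEntropy (tilted P₁ P₂ l) P₂} with hS₃
  have hc₁ := continuous_relEntropy_tilted_one h₁₂ h₂₁
  have hc₂ := continuous_relEntropy_tilted_two h₁₂ h₂₁
  have hC₁ : IsClosed S₁ := isClosed_le continuous_const hc₁
  have hC₂ : IsClosed S₂ := isClosed_le continuous_const hc₂
  have hC₃ : IsClosed S₃ :=
    (isClosed_le continuous_const hc₁).inter (isClosed_le continuous_const hc₂)
  have hcov : ∀ l, l ∈ S₁ ∨ l ∈ S₂ ∨ l ∈ S₃ := by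
    intro l
    have := isProbabilityMeasure_tilted h₁₂ h₂₁ l
    by_cases h1 : l ∈ S₁
    · exact Or.inl h1
    by_cases h2 : l ∈ S₂
    · exact Or.inr (Or.inl h2)
    exact Or.inr (Or.inr (le_relEntropy_of_mem_regionAFL hE
      (tilted_absolutelyContinuous h₁₂ h₂₁ l) ((tilted_absolutelyContinuous h₁₂ h₂₁ l).trans h₁₂)
      (not_le.1 h1) (not_le.1 h2)))
  have hz : relEntropy (tilted P₁ P₂ 0) P₁ = 0 := by rw [tilted_zero h₁₂ h₂₁, relEntropy_self]
  have ho : relEntropy (tilted P₁ P₂ 1) P₂ = 0 := by rw [tilted_one h₁₂ h₂₁, relEntropy_self]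
  -- At each endpoint one divergence is zero, so `γ > 0` keeps `S₃` away from it.
  have h0 : (0 : ℝ) ∈ S₂ := by
    rcases hcov 0 with h | h | h
    · exact absurd (hz ▸ h : E.1 ≤ 0) hpos.1.not_ge
    · exact h
    · exact absurd (hz ▸ h.1 : γ ≤ 0) hγ.not_ge
  have h1 : (1 : ℝ) ∈ S₁ := by
    rcases hcov 1 with h | h | h
    · exact h
    · exact absurd (ho ▸ h : E.2 ≤ 0) hpos.2.not_ge
    · exact absurd (ho ▸ h.2 : γ ≤ 0) hγ.not_ge
  have hconn := isPreconnected_closed_iff.1 (isPreconnected_Icc (a := (0 : ℝ)) (b := 1))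
  have hdisj : ∀ l ∈ Icc (0 : ℝ) 1, l ∈ S₁ → l ∉ S₂ := fun l hl h => not_le.2 (hT l hl h)
  -- As `S₁` and `S₂` are disjoint on the path, each must touch `S₃`. The two meeting points may
  -- differ, which is why the bound is a rectangle.
  obtain ⟨l, hl, hl₁, hl₃⟩ := hconn S₁ (S₂ ∪ S₃) hC₁ (hC₂.union hC₃) (fun l _ => hcov l)
    ⟨1, by simp, h1⟩ ⟨0, by simp, Or.inl h0⟩
  obtain ⟨l', hl', hl'₂, hl'₃⟩ := hconn S₂ (S₁ ∪ S₃) hC₂ (hC₁.union hC₃)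
    (fun l _ => or_left_comm.1 (hcov l)) ⟨0, by simp, h0⟩ ⟨1, by simp, Or.inl h1⟩
  exact Or.inr ⟨le_maxExponentOne h₁₂ h₂₁ hl (hl₃.resolve_left (hdisj l hl hl₁)).2 hl₁,
    le_maxExponentTwo h₁₂ h₂₁ hl'
      (hl'₃.resolve_left fun h => hdisj l' hl' h hl'₂).1 hl'₂⟩

/-- For `γ = 0` the endpoints of the path are themselves admissible witnesses, so only `Q = P₁` and
`Q = P₂` need testing. -/
lemma regionVanishing_subset_regionGamma (h₁₂ : P₁ ≪ P₂) (h₂₁ : P₂ ≪ P₁) (K : ℕ) :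
    regionVanishing P₁ P₂ K ⊆ regionGamma P₁ P₂ 0 := by
  intro E hE
  by_cases hpos : E.1 ≤ 0 ∨ E.2 ≤ 0
  · exact Or.inl (mem_regionFL_of_nonpos hpos)
  push Not at hpos
  have h2 : E.2 ≤ relEntropy P₁ P₂ :=
    (le_relEntropy_or_of_mem_regionVanishing hE Measure.AbsolutelyContinuous.rfl h₁₂
      (Or.inl rfl)).resolve_left (by rw [relEntropy_self]; exact hpos.1.not_ge)
  have h1 : E.1 ≤ relEntropy P₂ P₁ :=
    (le_relEntropy_or_of_mem_regionVanishing hE h₂₁ Measure.AbsolutelyContinuous.rfl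
      (Or.inr rfl)).resolve_right (by rw [relEntropy_self]; exact hpos.2.not_ge)
  refine Or.inr ⟨le_maxExponentOne h₁₂ h₂₁ (l := 1) (by simp) ?_ ?_,
    le_maxExponentTwo h₁₂ h₂₁ (l := 0) (by simp) ?_ ?_⟩
  · rw [tilted_one h₁₂ h₂₁, relEntropy_self]
  · rwa [tilted_one h₁₂ h₂₁]
  · rw [tilted_zero h₁₂ h₂₁, relEntropy_self]
  · rwa [tilted_zero h₁₂ h₂₁]

end Regions

end AFLTest

theorem mainTheorem6 {X : Type*} [Fintype X] [MeasurableSpace X] [MeasurableSingletonClass X]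
    (P₁ P₂ : Measure X) [IsProbabilityMeasure P₁] [IsProbabilityMeasure P₂]
    (h₁₂ : P₁ ≪ P₂) (h₂₁ : P₂ ≪ P₁) (K : ℕ) (hK : 1 ≤ K) :
    -- the converse for every exponent `γ > 0`
    (∀ γ : ℝ, 0 < γ →
      AFLTest.regionAFL P₁ P₂ γ K ⊆
        AFLTest.regionGamma P₁ P₂ γ ∩ (K : ℝ) • AFLTest.regionFL P₁ P₂) ∧
    -- the case `γ = 0`
    AFLTest.regionAFL P₁ P₂ 0 K ⊆ (K : ℝ) • AFLTest.regionFL P₁ P₂ ∧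
    AFLTest.regionVanishing P₁ P₂ K ⊆
      AFLTest.regionGamma P₁ P₂ 0 ∩ (K : ℝ) • AFLTest.regionFL P₁ P₂ ∧
    -- the explicit form of the fixed-length region for positive exponents
    AFLTest.regionFL P₁ P₂ ∩ Ioi 0 ×ˢ Ioi 0 = AFLTest.regionTilted P₁ P₂ ∩ Ioi 0 ×ˢ Ioi 0 := by
  refine ⟨fun γ hγ => subset_inter (AFLTest.regionAFL_subset_regionGamma h₁₂ h₂₁ hγ K)
      (AFLTest.regionAFL_subset_smul hK), AFLTest.regionAFL_subset_smul hK,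
    subset_inter (AFLTest.regionVanishing_subset_regionGamma h₁₂ h₂₁ K)
      (AFLTest.regionVanishing_subset_smul hK), ?_⟩
  ext E
  refine and_congr_left fun hE => ⟨fun h => ?_, fun h => ?_⟩
  · exact AFLTest.mem_regionTilted_of_mem_regionFL h₁₂ h₂₁ h hE.1 hE.2
  · exact AFLTest.regionTilted_subset_regionFL h₁₂ h₂₁ h
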